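/- Let $H$ be a real Hilbert space, let $\lambda\in\mathbb{R}$, and let $\Phi:H\to(-\infty,+\infty]$ be proper (i.e. $\operatorname{dom}\Phi:=\{x\in H:\Phi(x)\neq+\infty\}$ is non-empty), lower semicontinuous and $\lambda$-convex, i.e. for all $x,y\in H$ and $s\in[0,1]$, $$\Phi(sx+(1-s)y)\le s\,\Phi(x)+(1-s)\,\Phi(y)-\tfrac{\lambda}{2}\,s(1-s)\,\|x-y\|^2 .$$ Let $x_0\in\overline{\operatorname{dom}\Phi}$ and let $u:(0,+\infty)\to H$ be the gradient flow of $\Phi$ starting at $x_0$, that is: $u$ is locally absolutely continuous, $u(t)\to x_0$ as $t\downarrow 0$, and for a.e. $t>0$ and all $v\in H$ the evolution variational inequality $$\frac12\frac{d}{dt}\|u(t)-v\|^2+\frac{\lambda}{2}\|u(t)-v\|^2+\Phi(u(t))\le\Phi(v)$$ holds. For $t>0$ and $s\in\mathbb{R}$ put $\kappa(t,s):=\frac{e^{2st}-1}{2s}$ if $s\neq0$ and $\kappa(t,0):=t$, and for $\gamma>0$ let $$[\Phi]^{\gamma}(x):=\inf_{y\in H}\Big(\Phi(y)+\frac{1}{2\gamma}\|y-x\|^2\Big)$$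 be the Moreau envelope. Then, for all $t>0$, $$\Phi(u(t))\le[\Phi]^{\kappa(t,\lambda)}(x_0).$$ -/

import Mathlib

open Set Filter Topology MeasureTheory

noncomputable section

namespace GradFlow

variable {H : Type*}

/-- The effective domain of `Φ : H → (-∞, +∞]`. -/
def dom (Φ : H → EReal) : Set H := {x | Φ x ≠ ⊤}

/-- `Φ` takes values in `(-∞, +∞]` and is proper, that is, not identically `+∞`. -/
def IsProper (Φ : H → EReal) : Prop := (∀ x, Φ x ≠ ⊥) ∧ (dom Φ).Nonempty

variable [NormedAddCommGroup H]

/-- The function `Φ` is `lam`-convex: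
`Φ (t x + (1 - t) y) ≤ t Φ x + (1 - t) Φ y - (lam / 2) t (1 - t) ‖x - y‖²`. -/
def LambdaConvex [NormedSpace ℝ H] (lam : ℝ) (Φ : H → EReal) : Prop :=
  ∀ x y : H, ∀ t : ℝ, t ∈ Icc (0 : ℝ) 1 →
    Φ (t • x + (1 - t) • y) ≤
      (t : EReal) * Φ x + ((1 - t : ℝ) : EReal) * Φ y
        - ((1 / 2 * lam * t * (1 - t) * ‖x - y‖ ^ 2 : ℝ) : EReal)

/-- The Moreau envelope of `Φ` with parameter `γ > 0`, with values in `[-∞, +∞]`: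
the infimum over `y` of `Φ y + ‖y - x‖² / (2 γ)`. -/
def moreauEnvelope (Φ : H → EReal) (γ : ℝ) (x : H) : EReal :=
  ⨅ y : H, (Φ y + ((1 / (2 * γ) * ‖y - x‖ ^ 2 : ℝ) : EReal))

/-- The curve `u`, of which only the values on `(0, +∞)` matter, is the gradient flow of the
`lam`-convex function `Φ` starting at `x₀`. -/
structure IsGradientFlow (lam : ℝ) (Φ : H → EReal) (x₀ : H) (u : ℝ → H) : Prop where
  /-- `u` is absolutely continuous on every compact subinterval of `(0, +∞)`. -/
  locallyAC : ∀ a b : ℝ, 0 < a → a ≤ b → AbsolutelyContinuousOnInterval u a b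
  /-- `u t → x₀` as `t ↓ 0`. -/
  tendsto_initial : Tendsto u (𝓝[>] 0) (𝓝 x₀)
  /-- The evolution variational inequality: for almost every `t > 0` and all `v`,
  `(1/2) d/dt ‖u t - v‖² + (lam/2) ‖u t - v‖² + Φ (u t) ≤ Φ v`, the derivative `d` existing. -/
  evi : ∀ᵐ t ∂(volume.restrict (Ioi (0 : ℝ))), ∀ v : H, ∃ d : ℝ,
    HasDerivAt (fun s : ℝ => ‖u s - v‖ ^ 2) d t ∧
      ((1 / 2 * d + 1 / 2 * lam * ‖u t - v‖ ^ 2 : ℝ) : EReal) + Φ (u t) ≤ Φ v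

/-- `kappa t s = (exp (2 s t) - 1) / (2 s)` for `s ≠ 0` and `kappa t 0 = t`. -/
def kappa (t s : ℝ) : ℝ := if s = 0 then t else (Real.exp (2 * s * t) - 1) / (2 * s)

end GradFlow

end

/-! Fix `v` with `Φ v` finite. Along the flow, started at a time `s > 0`, the functional `kappa (t -
s) lam * (Φ (u t) - Φ v) + exp (lam * (t - s)) / 2 * ‖u t - v‖ ^ 2` does not increase. Dropping its
last term at time `t` and letting `s ↓ 0` gives the bound for each `v` (`kappa_mul_le`,
`le_add_of_ne_top`). For `lam > 0`, integrating the variational inequality alone yields only the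
constant `kappa t (lam / 2)`. The sharp one also needs the dissipation identity `(Φ ∘ u)' = -‖w‖ ^
2`, with `w` the weak velocity (`ae_exists_velocity`), after which the sign of the derivative is
algebra (`lyapunov_rate_nonpos`). The energy is only shown to be antitone (`antitoneOn`); its
possible downward jumps are harmless. -/

namespace GradFlow

/-! ### Monotonicity from almost everywhere derivatives -/

/-- A function whose increments are bounded by those of an absolutely continuous one is absolutely
continuous. -/
lemma absolutelyContinuousOnInterval_of_dist_le {X Y : Type*} [PseudoMetricSpace X]
    [PseudoMetricSpace Y] {f : ℝ → X} {g : ℝ → Y} {a b : ℝ}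
    (hf : AbsolutelyContinuousOnInterval f a b)
    (hg : ∀ x y, dist (g x) (g y) ≤ dist (f x) (f y)) :
    AbsolutelyContinuousOnInterval g a b := by
  rw [absolutelyContinuousOnInterval_iff] at hf ⊢
  intro ε hε
  obtain ⟨δ, hδ, h⟩ := hf ε hε
  exact ⟨δ, hδ, fun E hE hE' =>
    (Finset.sum_le_sum fun i _ => hg _ _).trans_lt (h E hE hE')⟩

lemma absolutelyContinuousOnInterval_norm_sub_sq {E : Type*} [NormedAddCommGroup E]
    {u : ℝ → E} {a b : ℝ} (hu : AbsolutelyContinuousOnInterval u a b) (v : E) :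
    AbsolutelyContinuousOnInterval (fun s => ‖u s - v‖ ^ 2) a b := by
  have h : AbsolutelyContinuousOnInterval (fun s => ‖u s - v‖) a b := by
    refine absolutelyContinuousOnInterval_of_dist_le hu fun x y => ?_
    simpa only [dist_sub_right] using dist_norm_norm_le (u x - v) (u y - v)
      |>.trans_eq (by rw [sub_sub_sub_cancel_right, dist_eq_norm])
  have h2 := h.mul h
  refine absolutelyContinuousOnInterval_of_dist_le h2 fun x y => le_of_eq ?_
  simp [sq]

/-- The sum of an antitone and an absolutely continuous function does not increase if its
derivative is nonpositive almost everywhere. -/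
lemma AntitoneOn.add_absolutelyContinuous_le {h K : ℝ → ℝ} {a b : ℝ} (hab : a ≤ b)
    (hh : AntitoneOn h (Icc a b)) (hK : AbsolutelyContinuousOnInterval K a b)
    (hd : ∀ᵐ x, x ∈ Ioo a b → deriv h x + deriv K x ≤ 0) :
    h b + K b ≤ h a + K a := by
  rw [← uIcc_of_le hab] at hh
  have hm : MonotoneOn (-h) (uIcc a b) := hh.neg
  -- The integral of the derivative of a monotone function is at most its increment, so a singular
  -- part of `h` has the favourable sign.
  have h1 := hm.intervalIntegral_deriv_mem_uIcc
  have hle : h b ≤ h a := hh (by simp) (by simp) hab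
  rw [uIcc_of_le (by simp [hle])] at h1
  have h2 := hK.integral_deriv_eq_sub
  have h3 : ∫ x in a..b, deriv K x ≤ ∫ x in a..b, deriv (-h) x := by
    refine intervalIntegral.integral_mono_ae_restrict hab hK.intervalIntegrable_deriv
      hm.intervalIntegrable_deriv ?_
    rw [Filter.EventuallyLE, ← restrict_Ioo_eq_restrict_Icc, ae_restrict_iff' measurableSet_Ioo]
    filter_upwards [hd] with x hx hxm
    have := hx hxm
    rw [deriv.neg]
    linarith
  have h4 := h1.2
  simp only [Pi.neg_apply] at h4
  linarith

/-- The function `A * f + G`, with `A ≥ 0` nondecreasing and continuously differentiable, `f`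
antitone and `G` absolutely continuous, does not increase if its derivative is nonpositive almost
everywhere. -/
lemma AntitoneOn.mul_add_absolutelyContinuous_le {f G A A' : ℝ → ℝ} {a b : ℝ} (hab : a ≤ b)
    (hf : AntitoneOn f (Icc a b)) (hG : AbsolutelyContinuousOnInterval G a b)
    (hA : ∀ x, HasDerivAt A (A' x) x) (hA' : Continuous A')
    (hA0 : ∀ x ∈ Icc a b, 0 ≤ A x) (hA'0 : ∀ x ∈ Icc a b, 0 ≤ A' x)
    (hd : ∀ᵐ x, x ∈ Ioo a b → ∃ f' G' : ℝ, HasDerivAt f f' x ∧ HasDerivAt G G' x ∧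
      A' x * f x + A x * f' + G' ≤ 0) :
    A b * f b + G b ≤ A a * f a + G a := by
  have hu := uIcc_of_le hab
  have hi : ∀ {x y}, x ∈ Icc a b → y ∈ Icc a b →
      IntervalIntegrable (fun x => A' x * f x) volume x y := by
    intro x y hx hy
    have : AntitoneOn f (uIcc x y) := hf.mono ((convex_Icc a b).ordConnected.uIcc_subset hx hy)
    exact this.intervalIntegrable.continuousOn_mul hA'.continuousOn
  have ha : a ∈ Icc a b := ⟨le_rfl, hab⟩
  have hb : b ∈ Icc a b := ⟨hab, le_rfl⟩
  have hJ : AbsolutelyContinuousOnInterval (fun x => ∫ y in a..x, A' y * f y) a b :=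
    (hi ha hb).absolutelyContinuousOnInterval_intervalIntegral (by simp)
  -- `f` may be negative, so `A * f` need not be antitone; formally `d(A f) - A' f dx = A df ≤ 0`.
  have hh : AntitoneOn (fun x => A x * f x - ∫ y in a..x, A' y * f y) (Icc a b) := by
    intro x hx y hy hxy
    have e : (∫ z in a..y, A' z * f z) = (∫ z in a..x, A' z * f z) + ∫ z in x..y, A' z * f z :=
      (intervalIntegral.integral_add_adjacent_intervals (hi ha hx) (hi hx hy)).symm
    have e2 : (A y - A x) * f y ≤ ∫ z in x..y, A' z * f z := by
      rw [← intervalIntegral.integral_eq_sub_of_hasDerivAt (fun z _ => hA z)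
        (hA'.intervalIntegrable _ _), ← intervalIntegral.integral_mul_const]
      refine intervalIntegral.integral_mono_on hxy
        ((hA'.mul continuous_const).intervalIntegrable _ _) (hi hx hy) fun z hz => ?_
      have hz' : z ∈ Icc a b := ⟨hx.1.trans hz.1, hz.2.trans hy.2⟩
      exact mul_le_mul_of_nonneg_left (hf hz' hy hz.2) (hA'0 z hz')
    have e3 := mul_le_mul_of_nonneg_left (hf hx hy hxy) (hA0 x hx)
    simp only [e]
    linarith
  have key := AntitoneOn.add_absolutelyContinuous_le hab hh (hJ.add hG) ?_
  · simp only [Pi.add_apply] at key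
    linarith
  filter_upwards [hd, (hi ha hb).ae_hasDerivAt_integral] with x hx hx2 hxm
  obtain ⟨f', G', h1, h2, h3⟩ := hx hxm
  have h4 := hx2 (by rw [hu]; exact Ioo_subset_Icc_self hxm) a (by simp)
  have h5 := ((hA x).mul h1).sub h4
  have h6 := h4.add h2
  have e5 : deriv (fun x => A x * f x - ∫ y in a..x, A' y * f y) x = _ := h5.deriv
  have e6 : deriv ((fun x => ∫ y in a..x, A' y * f y) + G) x = _ := h6.deriv
  rw [e5, e6]
  linarith

lemma hasDerivAt_norm_sub_self_sq {H : Type*} [NormedAddCommGroup H] {u : ℝ → H} {t : ℝ}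
    (h : DifferentiableAt ℝ (fun s => ‖u s - u t‖ ^ 2) t) :
    HasDerivAt (fun s => ‖u s - u t‖ ^ 2) 0 t := by
  have hm : IsLocalMin (fun s => ‖u s - u t‖ ^ 2) t :=
    Eventually.of_forall fun s => by simp
  simpa [hm.deriv_eq_zero] using h.hasDerivAt

/-! ### Monotonicity and finiteness of the energy -/

namespace IsGradientFlow

variable {H : Type*} [NormedAddCommGroup H] {lam : ℝ} {Φ : H → EReal} {x₀ : H} {u : ℝ → H}

lemma continuousOn (hu : IsGradientFlow lam Φ x₀ u) : ContinuousOn u (Ioi 0) := by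
  intro t ht
  have ht : 0 < t := ht
  have h := (hu.locallyAC (t / 2) (2 * t) (by linarith) (by linarith)).continuousOn
  rw [uIcc_of_le (by linarith)] at h
  exact (h.continuousAt (Icc_mem_nhds (by linarith) (by linarith))).continuousWithinAt

lemma evi_ae (hu : IsGradientFlow lam Φ x₀ u) : ∀ᵐ t, 0 < t → ∀ v : H, ∃ d : ℝ,
    HasDerivAt (fun s : ℝ => ‖u s - v‖ ^ 2) d t ∧
      ((1 / 2 * d + 1 / 2 * lam * ‖u t - v‖ ^ 2 : ℝ) : EReal) + Φ (u t) ≤ Φ v :=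
  (ae_restrict_iff' measurableSet_Ioi).1 hu.evi

/-- The energy `Φ` does not increase along the flow. -/
lemma antitoneOn (hu : IsGradientFlow lam Φ x₀ u)
    (hlsc : LowerSemicontinuous Φ) : AntitoneOn (fun t => Φ (u t)) (Ioi 0) := by
  intro s hs t ht hst
  have hs : 0 < s := hs
  by_contra! hlt
  obtain ⟨c, hc1, hc2⟩ := EReal.lt_iff_exists_real_btwn.1 hlt
  -- the last time before `t` at which the energy is at most `c`
  set S : Set ℝ := {τ ∈ Icc s t | Φ (u τ) ≤ c} with hS
  have hSne : S.Nonempty := ⟨s, ⟨le_rfl, hst⟩, hc1.le⟩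
  have hSc : IsClosed S := by
    have hcont : ContinuousOn u (Icc s t) :=
      hu.continuousOn.mono fun x hx => hs.trans_le hx.1
    exact hcont.preimage_isClosed_of_isClosed isClosed_Icc (hlsc.isClosed_preimage (c : EReal))
  have hSb : BddAbove S := ⟨t, fun x hx => hx.1.2⟩
  obtain ⟨⟨hαs, hαt⟩, hαc⟩ := hSc.csSup_mem hSne hSb
  set α := sSup S
  have hα0 : 0 < α := hs.trans_le hαs
  have hαlt : α < t := lt_of_le_of_ne hαt fun h => by
    rw [h] at hαc
    exact absurd hc2 (not_lt.2 hαc)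
  have hgt : ∀ τ ∈ Ioo α t, (c : EReal) < Φ (u τ) := by
    intro τ hτ
    by_contra! h
    exact absurd (le_csSup hSb (show τ ∈ S from ⟨⟨hαs.trans hτ.1.le, hτ.2.le⟩, h⟩))
      (not_le.2 hτ.1)
  set G : ℝ → ℝ := (fun τ => Real.exp (lam * τ)) * fun τ => ‖u τ - u α‖ ^ 2 with hGdef
  -- Testing with `u α`, whose energy is at most `c < Φ (u τ)`, makes `G` decrease strictly. But `G
  -- ≥ 0` and `G α = 0`, so `G` vanishes on `[α, t]`: a contradiction.
  have hGd : ∀ᵐ τ, τ ∈ Ioo α t → ∃ d < 0, HasDerivAt G d τ := by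
    filter_upwards [hu.evi_ae] with τ hτ hτm
    obtain ⟨d, hd, hle⟩ := hτ (hα0.trans hτm.1) (u α)
    have hneg : 1 / 2 * d + 1 / 2 * lam * ‖u τ - u α‖ ^ 2 < 0 := by
      by_contra! hn
      refine absurd ((hle.trans hαc).trans_lt (hgt τ hτm)) (not_lt.2 ?_)
      calc Φ (u τ) = 0 + Φ (u τ) := (zero_add _).symm
        _ ≤ _ := by gcongr; exact_mod_cast hn
    have he : HasDerivAt (fun τ => Real.exp (lam * τ)) (Real.exp (lam * τ) * (lam * 1)) τ :=
      ((hasDerivAt_id τ).const_mul lam).exp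
    refine ⟨_, ?_, he.mul hd⟩
    have := mul_neg_of_pos_of_neg (Real.exp_pos (lam * τ)) hneg
    linarith
  have hGac : AbsolutelyContinuousOnInterval G α t := by
    refine AbsolutelyContinuousOnInterval.mul ?_
      (absolutelyContinuousOnInterval_norm_sub_sq (hu.locallyAC α t hα0 hαt) _)
    have : ContDiff ℝ 1 fun τ => Real.exp (lam * τ) := by fun_prop
    exact this.contDiffOn.absolutelyContinuousOnInterval
  have hG0 : ∀ τ, 0 ≤ G τ := fun τ => mul_nonneg (Real.exp_pos _).le (sq_nonneg _)
  have hGz : ∀ τ ∈ Icc α t, G τ = 0 := by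
    intro τ hτ
    refine le_antisymm ?_ (hG0 τ)
    have := AntitoneOn.add_absolutelyContinuous_le (h := fun _ => 0) hτ.1 antitoneOn_const
      (hGac.mono (by rw [uIcc_of_le hτ.1, uIcc_of_le hαt]; exact Icc_subset_Icc_right hτ.2)) ?_
    · simpa [hGdef] using this
    filter_upwards [hGd] with x hx hxm
    obtain ⟨d, hd0, hd⟩ := hx ⟨hxm.1, hxm.2.trans_le hτ.2⟩
    rw [hd.deriv, deriv_const]
    linarith
  have hpos : volume (Ioo α t) ≠ 0 := by simp [hαlt]
  obtain ⟨τ, hτm, hτ⟩ : ∃ τ ∈ Ioo α t, ∃ d < 0, HasDerivAt G d τ := by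
    by_contra! hcon
    refine hpos (measure_mono_null (fun τ hτ => ?_) (ae_iff.1 hGd))
    simp only [Set.mem_ofPred_eq]
    rintro h
    obtain ⟨d, hd0, hd⟩ := h hτ
    exact hcon τ hτ d hd0 hd
  obtain ⟨d, hd0, hd⟩ := hτ
  have h0 : HasDerivAt G 0 τ := by
    refine (hasDerivAt_const τ (0 : ℝ)).congr_of_eventuallyEq ?_
    filter_upwards [Icc_mem_nhds hτm.1 hτm.2] with x hx using hGz x hx
  exact hd0.ne (hd.unique h0)

lemma ne_top (hu : IsGradientFlow lam Φ x₀ u) (hprop : IsProper Φ)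
    (hlsc : LowerSemicontinuous Φ) {t : ℝ} (ht : 0 < t) : Φ (u t) ≠ ⊤ := by
  obtain ⟨v, hv⟩ := hprop.2
  have hpos : volume (Ioo 0 t) ≠ 0 := by simp [ht]
  obtain ⟨s, hsm, hs⟩ : ∃ s ∈ Ioo 0 t, Φ (u s) ≠ ⊤ := by
    by_contra! hcon
    refine hpos (measure_mono_null (fun τ hτ => ?_) (ae_iff.1 hu.evi_ae))
    simp only [Set.mem_ofPred_eq]
    intro h
    obtain ⟨d, -, hd⟩ := h hτ.1 v
    rw [hcon τ hτ, EReal.coe_add_top, top_le_iff] at hd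
    exact hv hd
  exact ne_top_of_le_ne_top hs (hu.antitoneOn hlsc hsm.1 ht hsm.2.le)

end IsGradientFlow

/-! ### Weak velocity and energy dissipation -/

section Hilbert

variable {H : Type*} [NormedAddCommGroup H] [InnerProductSpace ℝ H]

/-- A curve for which the squared distance to every point is differentiable at `t` is weakly
differentiable at `t`. -/
lemma exists_weak_hasDerivAt [CompleteSpace H] {u : ℝ → H} {t : ℝ}
    (h : ∀ v : H, DifferentiableAt ℝ (fun s => ‖u s - v‖ ^ 2) t) :
    ∃ w : H, ∀ v : H, HasDerivAt (fun s => inner ℝ (u s) v) (inner ℝ w v) t := by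
  have hd : ∀ v : H, DifferentiableAt ℝ (fun s => inner ℝ (u s) v) t := by
    intro v
    have e : (fun s => inner ℝ (u s) v) =
        fun s => (‖u s - 0‖ ^ 2 - ‖u s - v‖ ^ 2 + ‖v‖ ^ 2) / 2 := by
      funext s
      rw [norm_sub_sq_real (u s) v, sub_zero]
      ring
    rw [e]
    exact (((h 0).sub (h v)).add_const _).div_const _
  -- The difference quotients converge as functionals at each `v`; by Banach–Steinhaus the limit is
  -- bounded, and Riesz represents it by `w`.
  have ht : Tendsto (fun (s : ℝ) (v : H) => innerSL ℝ ((s - t)⁻¹ • (u s - u t)) v) (𝓝[≠] t)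
      (𝓝 fun v => deriv (fun s => inner ℝ (u s) v) t) := by
    rw [tendsto_pi_nhds]
    intro v
    refine (hasDerivAt_iff_tendsto_slope.1 (hd v).hasDerivAt).congr fun s => ?_
    simp [slope_def_field, div_eq_inv_mul]
  refine ⟨(InnerProductSpace.toDual ℝ H).symm (continuousLinearMapOfTendsto _ ht), fun v => ?_⟩
  rw [InnerProductSpace.toDual_symm_apply]
  exact (hd v).hasDerivAt

lemma hasDerivAt_norm_sub_sq_of_weak {u : ℝ → H} {t : ℝ} {w : H}
    (h : DifferentiableAt ℝ (fun s => ‖u s - u t‖ ^ 2) t)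
    (hw : ∀ v : H, HasDerivAt (fun s => inner ℝ (u s) v) (inner ℝ w v) t) (v : H) :
    HasDerivAt (fun s => ‖u s - v‖ ^ 2) (2 * inner ℝ w (u t - v)) t := by
  have e : (fun s => ‖u s - v‖ ^ 2) = fun s =>
      ‖u s - u t‖ ^ 2 + 2 * inner ℝ (u s) (u t - v)
        + (‖u t - v‖ ^ 2 - 2 * inner ℝ (u t) (u t - v)) := by
    funext s
    have : u s - v = (u s - u t) + (u t - v) := by abel
    rw [this, norm_add_sq_real, inner_sub_left]
    ring
  rw [e]
  simpa using ((hasDerivAt_norm_sub_self_sq h).add ((hw (u t - v)).const_mul 2)).add_const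
    (‖u t - v‖ ^ 2 - 2 * inner ℝ (u t) (u t - v))

namespace IsGradientFlow

variable {lam : ℝ} {Φ : H → EReal} {x₀ : H} {u : ℝ → H}

/-- The differential properties of the flow at almost every time: `u` has a weak derivative `w`,
`-w` is a subgradient of `Φ` at `u t`, and the energy dissipates at rate `‖w‖²`. -/
lemma ae_exists_velocity [CompleteSpace H] (hu : IsGradientFlow lam Φ x₀ u) (hprop : IsProper Φ)
    (hlsc : LowerSemicontinuous Φ) : ∀ᵐ t, 0 < t → ∃ w : H,
      (∀ v, HasDerivAt (fun s => ‖u s - v‖ ^ 2) (2 * inner ℝ w (u t - v)) t) ∧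
      (∀ v, Φ v ≠ ⊤ → inner ℝ w (u t - v) + lam / 2 * ‖u t - v‖ ^ 2 + (Φ (u t)).toReal
        ≤ (Φ v).toReal) ∧
      HasDerivAt (fun s => (Φ (u s)).toReal) (-‖w‖ ^ 2) t := by
  have hmono : MonotoneOn (fun s => -(Φ (u s)).toReal) (Ioi 0) := by
    intro s hs t ht hst
    exact neg_le_neg (EReal.toReal_le_toReal (hu.antitoneOn hlsc hs ht hst)
      (hprop.1 _) (hu.ne_top hprop hlsc hs))
  filter_upwards [hu.evi_ae, hmono.ae_differentiableWithinAt_of_mem] with t hevi hdiff ht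
  have hevi := hevi ht
  have hfd : DifferentiableAt ℝ (fun s => (Φ (u s)).toReal) t := by
    have := ((hdiff ht).differentiableAt (Ioi_mem_nhds ht)).neg
    simpa [Pi.neg_def] using this
  have hqd : ∀ v : H, DifferentiableAt ℝ (fun s => ‖u s - v‖ ^ 2) t := fun v => by
    obtain ⟨d, hd, -⟩ := hevi v
    exact hd.differentiableAt
  obtain ⟨w, hw⟩ := exists_weak_hasDerivAt hqd
  have hwq := hasDerivAt_norm_sub_sq_of_weak (hqd (u t)) hw
  have hsub : ∀ v, Φ v ≠ ⊤ → inner ℝ w (u t - v) + lam / 2 * ‖u t - v‖ ^ 2 + (Φ (u t)).toReal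
      ≤ (Φ v).toReal := by
    intro v hv
    obtain ⟨d, hd, hle⟩ := hevi v
    rw [hd.unique (hwq v), ← EReal.coe_toReal hv (hprop.1 v),
      ← EReal.coe_toReal (hu.ne_top hprop hlsc ht) (hprop.1 _)] at hle
    norm_cast at hle
    linarith
  refine ⟨w, hwq, hsub, ?_⟩
  -- By `hsub` at `v = u s`, this function of `s` is minimal at `s = t`; its vanishing derivative is
  -- the dissipation identity.
  have hψ : HasDerivAt (fun s => (Φ (u s)).toReal + inner ℝ (u s) w
      - lam / 2 * ‖u s - u t‖ ^ 2)
      (deriv (fun s => (Φ (u s)).toReal) t + inner ℝ w w - lam / 2 * 0) t :=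
    (hfd.hasDerivAt.add (hw w)).sub
      ((hasDerivAt_norm_sub_self_sq (hqd (u t))).const_mul (lam / 2))
  have hmin : IsLocalMin (fun s => (Φ (u s)).toReal + inner ℝ (u s) w
      - lam / 2 * ‖u s - u t‖ ^ 2) t := by
    filter_upwards [Ioi_mem_nhds ht] with s hs
    have := hsub (u s) (hu.ne_top hprop hlsc hs)
    rw [inner_sub_right, real_inner_comm (u t) w, real_inner_comm (u s) w, norm_sub_rev] at this
    simp only [sub_self, norm_zero]
    linarith
  have h0 := hmin.hasDerivAt_eq_zero hψ
  rw [real_inner_self_eq_norm_sq] at h0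
  have : deriv (fun s => (Φ (u s)).toReal) t = -‖w‖ ^ 2 := by linarith
  exact this ▸ hfd.hasDerivAt

end IsGradientFlow

end Hilbert

/-! ### The function `kappa` and the Lyapunov functional -/

lemma hasDerivAt_kappa (lam t : ℝ) :
    HasDerivAt (fun t => kappa t lam) (Real.exp (2 * lam * t)) t := by
  by_cases h : lam = 0
  · simpa [kappa, h] using hasDerivAt_id' t
  · simp only [kappa, h, if_false]
    have := ((((hasDerivAt_id' t).const_mul (2 * lam)).exp).sub_const 1).div_const (2 * lam)
    convert! this using 1
    field_simp

lemma two_mul_kappa (lam t : ℝ) : 2 * lam * kappa t lam = Real.exp (2 * lam * t) - 1 := by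
  by_cases h : lam = 0
  · simp [h]
  · simp only [kappa, h, if_false]
    field_simp

lemma kappa_zero (lam : ℝ) : kappa 0 lam = 0 := by simp [kappa]

lemma kappa_strictMono (lam : ℝ) : StrictMono fun t => kappa t lam :=
  strictMono_of_hasDerivAt_pos (hasDerivAt_kappa lam) fun _ => Real.exp_pos _

lemma kappa_pos (lam : ℝ) {t : ℝ} (ht : 0 < t) : 0 < kappa t lam := by
  simpa [kappa_zero] using kappa_strictMono lam ht

lemma kappa_nonneg (lam : ℝ) {t : ℝ} (ht : 0 ≤ t) : 0 ≤ kappa t lam := by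
  simpa [kappa_zero] using (kappa_strictMono lam).monotone ht

/-- The pointwise inequality behind the Lyapunov functional: with `E = exp (lam t)`, `κ = kappa`,
`δ` the energy gap, `q` the squared distance, `m` its rate of decrease and `n` the dissipation. -/
lemma lyapunov_rate_nonpos {lam κ E δ q m n : ℝ} (hE : 0 < E) (hκ : 0 < κ)
    (hκE : 2 * lam * κ = E ^ 2 - 1) (hq : 0 ≤ q) (hn : 0 ≤ n) (hmn : m ^ 2 ≤ n * q)
    (hδ : δ ≤ m - lam / 2 * q) :
    E ^ 2 * δ + κ * -n + (lam * E * q / 2 - E * m) ≤ 0 := by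
  have h1 : E ^ 2 * δ ≤ E ^ 2 * (m - lam / 2 * q) := mul_le_mul_of_nonneg_left hδ (sq_nonneg E)
  suffices h : (E ^ 2 - E) * (m - lam / 2 * q) ≤ κ * n by linarith
  rcases hq.eq_or_lt with rfl | hq
  · have hm : m = 0 := by
      rw [mul_zero] at hmn
      exact pow_eq_zero_iff two_ne_zero |>.1 (le_antisymm hmn (sq_nonneg m))
    simpa [hm] using mul_nonneg hκ.le hn
  -- Completing the square in `m`; by `hκE` the remainder is `E * (E - 1) ^ 2 * q ^ 2`.
  have h2 : 0 ≤ (2 * κ * m - (E ^ 2 - E) * q) ^ 2 + E * (E - 1) ^ 2 * q ^ 2 := by positivity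
  have h3 : (2 * κ * m - (E ^ 2 - E) * q) ^ 2 + E * (E - 1) ^ 2 * q ^ 2
      = 4 * κ * (κ * m ^ 2 - (E ^ 2 - E) * (m - lam / 2 * q) * q) := by
    linear_combination (-(E ^ 2 - E) * q ^ 2) * hκE
  have h4 : 0 ≤ κ * m ^ 2 - (E ^ 2 - E) * (m - lam / 2 * q) * q :=
    nonneg_of_mul_nonneg_right (h3 ▸ h2) (by positivity)
  have h5 := mul_le_mul_of_nonneg_left hmn hκ.le
  refine le_of_mul_le_mul_right ?_ hq
  linarith

namespace IsGradientFlow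

variable {H : Type*} [NormedAddCommGroup H] [InnerProductSpace ℝ H] [CompleteSpace H]
  {lam : ℝ} {Φ : H → EReal} {x₀ : H} {u : ℝ → H}

/-- The Lyapunov inequality between the times `s` and `t`. -/
lemma kappa_mul_le (hu : IsGradientFlow lam Φ x₀ u) (hprop : IsProper Φ)
    (hlsc : LowerSemicontinuous Φ) {s t : ℝ} (hs : 0 < s) (hst : s ≤ t) {v : H} (hv : Φ v ≠ ⊤) :
    kappa (t - s) lam * ((Φ (u t)).toReal - (Φ v).toReal) ≤ 1 / 2 * ‖u s - v‖ ^ 2 := by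
  set G : ℝ → ℝ := (fun τ => Real.exp (lam * (τ - s)) * (1 / 2)) * fun τ => ‖u τ - v‖ ^ 2
    with hGdef
  have hf : AntitoneOn (fun τ => (Φ (u τ)).toReal - (Φ v).toReal) (Icc s t) := by
    intro x hx y hy hxy
    have hx0 : 0 < x := hs.trans_le hx.1
    exact sub_le_sub_right (EReal.toReal_le_toReal
      (hu.antitoneOn hlsc hx0 (hs.trans_le hy.1) hxy)
      (hprop.1 _) (hu.ne_top hprop hlsc hx0)) _
  have hG : AbsolutelyContinuousOnInterval G s t := by
    refine AbsolutelyContinuousOnInterval.mul ?_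
      (absolutelyContinuousOnInterval_norm_sub_sq (hu.locallyAC s t hs hst) _)
    have : ContDiff ℝ 1 fun τ => Real.exp (lam * (τ - s)) * (1 / 2) := by fun_prop
    exact this.contDiffOn.absolutelyContinuousOnInterval
  have key := AntitoneOn.mul_add_absolutelyContinuous_le (A := fun τ => kappa (τ - s) lam)
    (A' := fun τ => Real.exp (2 * lam * (τ - s))) hst hf hG
    (fun x => (hasDerivAt_kappa lam (x - s)).comp_sub_const x s) (by fun_prop)
    (fun x hx => kappa_nonneg lam (sub_nonneg.2 hx.1)) (fun x _ => (Real.exp_pos _).le) ?_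
  · simp only [hGdef, Pi.mul_apply, sub_self, kappa_zero, mul_zero, Real.exp_zero] at key
    have : 0 ≤ Real.exp (lam * (t - s)) * (1 / 2) * ‖u t - v‖ ^ 2 := by positivity
    linarith
  filter_upwards [hu.ae_exists_velocity hprop hlsc] with x hx hxm
  obtain ⟨w, hq, hsub, hfd⟩ := hx (hs.trans hxm.1)
  have he : HasDerivAt (fun τ => Real.exp (lam * (τ - s)) * (1 / 2))
      (Real.exp (lam * (x - s)) * (lam * 1) * (1 / 2)) x :=
    ((((hasDerivAt_id' x).sub_const s).const_mul lam).exp).mul_const _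
  refine ⟨_, _, hfd.sub_const _, he.mul (hq v), ?_⟩
  have hE2 : Real.exp (2 * lam * (x - s)) = Real.exp (lam * (x - s)) ^ 2 := by
    rw [← Real.exp_nat_mul]
    congr 1
    push_cast
    ring
  have hcs : (-inner ℝ w (u x - v)) ^ 2 ≤ ‖w‖ ^ 2 * ‖u x - v‖ ^ 2 := by
    rw [neg_sq, ← mul_pow]
    exact sq_le_sq' (neg_le_of_abs_le (abs_real_inner_le_norm _ _)) (real_inner_le_norm _ _)
  have hgap := hsub v hv
  have := lyapunov_rate_nonpos (Real.exp_pos (lam * (x - s)))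
    (kappa_pos lam (sub_pos.2 hxm.1)) ((two_mul_kappa lam (x - s)).trans (by rw [hE2]))
    (sq_nonneg ‖u x - v‖) (sq_nonneg ‖w‖) hcs
    (show (Φ (u x)).toReal - (Φ v).toReal ≤ _ by linarith)
  rw [hE2]
  linarith

/-- The start time `s` tends to `0` only here: `Φ x₀` may be infinite, but the bound at `s` involves
only `‖u s - v‖`, which converges. -/
lemma le_add_of_ne_top (hu : IsGradientFlow lam Φ x₀ u) (hprop : IsProper Φ)
    (hlsc : LowerSemicontinuous Φ) {t : ℝ} (ht : 0 < t) {v : H} (hv : Φ v ≠ ⊤) :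
    kappa t lam * ((Φ (u t)).toReal - (Φ v).toReal) ≤ 1 / 2 * ‖x₀ - v‖ ^ 2 := by
  have hκ : Tendsto (fun s => kappa (t - s) lam * ((Φ (u t)).toReal - (Φ v).toReal)) (𝓝[>] 0)
      (𝓝 (kappa t lam * ((Φ (u t)).toReal - (Φ v).toReal))) := by
    have hc : ContinuousAt (fun s => kappa (t - s) lam) 0 :=
      ((hasDerivAt_kappa lam (t - 0)).continuousAt).comp (by fun_prop)
    have := hc.tendsto
    rw [sub_zero] at this
    exact (this.mono_left nhdsWithin_le_nhds).mul_const _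
  have hq : Tendsto (fun s => 1 / 2 * ‖u s - v‖ ^ 2) (𝓝[>] 0) (𝓝 (1 / 2 * ‖x₀ - v‖ ^ 2)) :=
    ((hu.tendsto_initial.sub_const v).norm.pow 2).const_mul _
  refine le_of_tendsto_of_tendsto hκ hq ?_
  filter_upwards [Ioo_mem_nhdsGT ht] with s hs
  exact hu.kappa_mul_le hprop hlsc hs.1 hs.2.le hv

end IsGradientFlow

end GradFlow

theorem mainTheorem4 {H : Type*} [NormedAddCommGroup H] [InnerProductSpace ℝ H] [CompleteSpace H]
    (lam : ℝ) (Φ : H → EReal)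
    (hproper : GradFlow.IsProper Φ)
    (hconvex : GradFlow.LambdaConvex lam Φ)
    (hlsc : LowerSemicontinuous Φ)
    (x₀ : H) (hx₀ : x₀ ∈ closure (GradFlow.dom Φ))
    (u : ℝ → H) (hu : GradFlow.IsGradientFlow lam Φ x₀ u) :
    ∀ t : ℝ, 0 < t → Φ (u t) ≤ GradFlow.moreauEnvelope Φ (GradFlow.kappa t lam) x₀ := by
  intro t ht
  refine le_iInf fun v => ?_
  by_cases hv : Φ v = ⊤
  · rw [hv, EReal.top_add_coe]
    exact le_top
  have h := hu.le_add_of_ne_top hproper hlsc ht hv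
  have hκ := GradFlow.kappa_pos lam ht
  rw [← EReal.coe_toReal hv (hproper.1 v),
    ← EReal.coe_toReal (hu.ne_top hproper hlsc ht) (hproper.1 _)]
  norm_cast
  rw [norm_sub_rev v x₀, ← sub_le_iff_le_add']
  have e : 1 / (2 * GradFlow.kappa t lam) * ‖x₀ - v‖ ^ 2
      = 1 / 2 * ‖x₀ - v‖ ^ 2 / GradFlow.kappa t lam := by
    field_simp
  rwa [e, le_div_iff₀' hκ]
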